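/- Let $p$ be a prime and $d\ge 1$. A *deformed ultrametric* on $\mathbb{Q}_p^d$ is a metric of the form $\widetilde d(x,y)=\max_{l} q_l\,|(Ux-Uy)_l|_p$, where $p^{-1}<q_l\le 1$ for $l=1,\dots,d$ and $U$ is a linear map of $\mathbb{Q}_p^d$ which preserves the norm $\max_l|x_l|_p$. A *dilation* with respect to $\widetilde d$ is a linear map $\mathbb{Q}_p^d\to\mathbb{Q}_p^d$ which maps every $\widetilde d$-ball (of positive radius) with center zero onto a maximal proper $\widetilde d$-subball with center zero of this ball. Let $A$ be a $d\times d$ matrix with integer entries which is a dilation with respect to some deformed ultrametric $\widetilde d$. Let $D\subset\mathbb{Z}^d$ be a finite set of digits with $0\in D$, containing exactly one representative of each class of $\mathbb{Z}_p^d/A\mathbb{Z}_p^d$. Every $x\in\mathbb{Q}_p^d$ has a unique expansion $x=\sum_{i\ge\gamma}A^i x_i$ with $x_i\in D$ (unique up to adding or removing initial zero digits). Assume that the series $\sum_{i\ge\gamma}A^{-i-1}x_i$ converge in $\mathbb{R}^d$ for all $\gamma\in\mathbb{Z}$ and all sequences of digits $x_i\in D$, so that the map $$\rho:\mathbb{Q}_p^d\to\mathbb{R}^d,\qquad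 \rho\Big(\sum_{i=\gamma}^{\infty}A^i x_i\Big)=\sum_{i=\gamma}^{\infty}A^{-i-1}x_i$$ is well defined, and put $R=\{\sum_{i=0}^\infty A^{-i-1}x_i : x_i\in D\}\subset\mathbb{R}^d$. Assume that $\rho$ conserves the measure: for every Borel set $S\subset\mathbb{Q}_p^d$ the Lebesgue measure of $\rho(S)$ is equal to the Haar measure of $S$, where the Haar measure is normalized so that $\mathbb{Z}_p^d$ has measure one. Then $R=\rho(\mathbb{Z}_p^d)$, and: 1. (A) $D$ contains exactly one representative of each class of $\mathbb{Z}^d/A\mathbb{Z}^d$, and $R$ is Lebesgue measurable with Lebesgue measure one; (B) for every non-zero $k\in\mathbb{Z}^d$ the set $R\cap(R+k)$ has Lebesgue measure zero. 2. $|\det A|_p=|\det A|^{-1}$. -/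

import Mathlib

open MeasureTheory

noncomputable section

/-- The Borel σ-algebra of `ℚ_p^d`. -/
instance padicVecMeasurableSpace (p : ℕ) [Fact p.Prime] (d : ℕ) :
    MeasurableSpace (Fin d → ℚ_[p]) := borel _

instance padicVecBorelSpace (p : ℕ) [Fact p.Prime] (d : ℕ) :
    BorelSpace (Fin d → ℚ_[p]) := ⟨rfl⟩

/-- The set `ℤ_p^d ⊆ ℚ_p^d`; here `‖x‖` is the maximum of the `p`-adic norms of the coordinates. -/
def padicUnitBall (p : ℕ) [Fact p.Prime] (d : ℕ) : Set (Fin d → ℚ_[p]) := {x | ‖x‖ ≤ 1}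

/-- The compact set `ℤ_p^d`, bundled with the fact that it has non-empty interior. -/
def padicUnitBallCompacts (p : ℕ) [Fact p.Prime] (d : ℕ) :
    TopologicalSpace.PositiveCompacts (Fin d → ℚ_[p]) where
  carrier := padicUnitBall p d
  isCompact' := by
    have h : padicUnitBall p d = Metric.closedBall 0 1 := by
      ext x; simp [padicUnitBall]
    rw [h]
    exact isCompact_closedBall 0 1
  interior_nonempty' := by
    refine ⟨0, mem_interior.2 ⟨Metric.ball 0 1, ?_, Metric.isOpen_ball, by simp⟩⟩
    intro x hx
    have : ‖x‖ < 1 := by simpa using hx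
    exact this.le

/-- The Haar measure on `ℚ_p^d`, normalised so that `ℤ_p^d` has measure one. -/
def padicHaar (p : ℕ) [Fact p.Prime] (d : ℕ) : Measure (Fin d → ℚ_[p]) :=
  Measure.addHaarMeasure (padicUnitBallCompacts p d)

/-- `δ` is a deformed ultrametric on `ℚ_p^d`: a weighted maximum metric
`max_l q_l |x_l - y_l|_p` with weights `1/p < q_l ≤ 1`, transformed by a linear map `U` which
conserves the maximum norm. -/
def IsDeformedMetric {p : ℕ} [Fact p.Prime] {d : ℕ}
    (δ : (Fin d → ℚ_[p]) → (Fin d → ℚ_[p]) → ℝ) : Prop :=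
  ∃ (q : Fin d → ℝ) (U : (Fin d → ℚ_[p]) ≃ₗᵢ[ℚ_[p]] (Fin d → ℚ_[p])),
    (∀ l, (p : ℝ)⁻¹ < q l ∧ q l ≤ 1) ∧
      ∀ x y, δ x y = ⨆ l, q l * ‖U x l - U y l‖

/-- `B` is a ball of positive radius with the center in zero. -/
def IsZeroBall {V : Type*} [Zero V] (δ : V → V → ℝ) (B : Set V) : Prop :=
  ∃ r : ℝ, 0 < r ∧ B = {x | δ x 0 ≤ r}

/-- `B'` is a maximal proper subball (with the center in zero) of `B`. -/
def IsMaximalSubball {V : Type*} [Zero V] (δ : V → V → ℝ) (B' B : Set V) : Prop :=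
  IsZeroBall δ B' ∧ B' ⊂ B ∧ ∀ C, IsZeroBall δ C → B' ⊆ C → C ⊂ B → C = B'

/-- A dilation maps any ball with the center in zero to a maximal subball of this ball. -/
def IsDilation {p : ℕ} [Fact p.Prime] {d : ℕ} (δ : (Fin d → ℚ_[p]) → (Fin d → ℚ_[p]) → ℝ)
    (T : (Fin d → ℚ_[p]) →ₗ[ℚ_[p]] (Fin d → ℚ_[p])) : Prop :=
  ∀ B, IsZeroBall δ B → IsMaximalSubball δ (T '' B) B

/-- An integer matrix, seen over a ring `K`. -/
def matCast (K : Type*) [Ring K] {d : ℕ} (A : Matrix (Fin d) (Fin d) ℤ) :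
    Matrix (Fin d) (Fin d) K := A.map (Int.castRingHom K)

/-- An integer vector, seen over a ring `K`. -/
def vecCast (K : Type*) [Ring K] {d : ℕ} (n : Fin d → ℤ) : Fin d → K := fun l => (n l : K)

/-- The integer vectors in `D` represent every class of `ℤ_p^d / A ℤ_p^d` exactly once. -/
def IsPadicDigitSet (p : ℕ) [Fact p.Prime] {d : ℕ} (A : Matrix (Fin d) (Fin d) ℤ)
    (D : Finset (Fin d → ℤ)) : Prop :=
  ∀ x ∈ padicUnitBall p d, ∃! n, n ∈ D ∧
    ∃ y ∈ padicUnitBall p d, x - vecCast ℚ_[p] n = (matCast ℚ_[p] A).mulVec y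

/-- The integer vectors in `D` represent every class of `ℤ^d / A ℤ^d` exactly once. -/
def IsIntegerDigitSet {d : ℕ} (A : Matrix (Fin d) (Fin d) ℤ) (D : Finset (Fin d → ℤ)) : Prop :=
  ∀ x : Fin d → ℤ, ∃! n, n ∈ D ∧ ∃ y : Fin d → ℤ, x - n = A.mulVec y

/-- A sequence of digits `(c_i)`, `i ≥ γ`, continued by zero to all integers `i`. -/
def IsDigitSeq {d : ℕ} (D : Finset (Fin d → ℤ)) (c : ℤ → Fin d → ℤ) : Prop :=
  (∀ i, c i ∈ D) ∧ ∃ γ : ℤ, ∀ i < γ, c i = 0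

/-- `x = ∑ A^i c_i` in `ℚ_p^d`. -/
def IsPadicExpansion (p : ℕ) [Fact p.Prime] {d : ℕ} (A : Matrix (Fin d) (Fin d) ℤ)
    (D : Finset (Fin d → ℤ)) (x : Fin d → ℚ_[p]) (c : ℤ → Fin d → ℤ) : Prop :=
  IsDigitSeq D c ∧ HasSum (fun i : ℤ => (matCast ℚ_[p] A ^ i).mulVec (vecCast ℚ_[p] (c i))) x

open Classical in
/-- The digits of `x` in its expansion `x = ∑ A^i x_i`. -/
def padicDigits (p : ℕ) [Fact p.Prime] {d : ℕ} (A : Matrix (Fin d) (Fin d) ℤ)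
    (D : Finset (Fin d → ℤ)) (x : Fin d → ℚ_[p]) : ℤ → Fin d → ℤ :=
  if h : ∃ c, IsPadicExpansion p A D x c then h.choose else 0

/-- The `i`-th term `A^{-i-1} c_i ∈ ℝ^d` of the real series. -/
def realTerm {d : ℕ} (A : Matrix (Fin d) (Fin d) ℤ) (c : ℤ → Fin d → ℤ) (i : ℤ) : Fin d → ℝ :=
  (matCast ℝ A ^ (-i - 1)).mulVec (vecCast ℝ (c i))

/-- The map `ρ : ∑ A^i x_i ↦ ∑ A^{-i-1} x_i` from `ℚ_p^d` to `ℝ^d`. -/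
def rho (p : ℕ) [Fact p.Prime] {d : ℕ} (A : Matrix (Fin d) (Fin d) ℤ)
    (D : Finset (Fin d → ℤ)) (x : Fin d → ℚ_[p]) : Fin d → ℝ :=
  ∑' i : ℤ, realTerm A (padicDigits p A D x) i

/-- All the real series that define `ρ` converge. -/
def RealSeriesConverge {d : ℕ} (A : Matrix (Fin d) (Fin d) ℤ) (D : Finset (Fin d → ℤ)) : Prop :=
  ∀ c, IsDigitSeq D c → Summable (realTerm A c)

/-- The Lebesgue measure of the image of a set is equal to the Haar measure of this set. -/
def ConservesMeasure {p : ℕ} [Fact p.Prime] {d : ℕ} (f : (Fin d → ℚ_[p]) → (Fin d → ℝ)) : Prop :=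
  ∀ S, MeasurableSet S → volume (f '' S) = padicHaar p d S

/-- The set `R = {∑_{i ≥ 0} A^{-i-1} x_i : x_i ∈ D} ⊆ ℝ^d`. -/
def realTile {d : ℕ} (A : Matrix (Fin d) (Fin d) ℤ) (D : Finset (Fin d → ℤ)) :
    Set (Fin d → ℝ) :=
  {y | ∃ c : ℕ → Fin d → ℤ, (∀ i, c i ∈ D) ∧
    HasSum (fun i : ℕ => ((matCast ℝ A)⁻¹ ^ (i + 1)).mulVec (vecCast ℝ (c i))) y}

/-- Condition (A): `D` is a set of representatives of `ℤ^d / A ℤ^d`, and `R` is Lebesgue measurable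
with measure one. -/
def ConditionA {d : ℕ} (A : Matrix (Fin d) (Fin d) ℤ) (D : Finset (Fin d → ℤ)) : Prop :=
  IsIntegerDigitSet A D ∧ NullMeasurableSet (realTile A D) volume ∧ volume (realTile A D) = 1

/-- Condition (B): `R ∩ (R + k)` has Lebesgue measure zero for every non-zero `k ∈ ℤ^d`. -/
def ConditionB {d : ℕ} (A : Matrix (Fin d) (Fin d) ℤ) (D : Finset (Fin d → ℤ)) : Prop :=
  ∀ k : Fin d → ℤ, k ≠ 0 →
    volume (realTile A D ∩ (fun y => y + vecCast ℝ k) '' realTile A D) = 0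

end

/-! The norm takes only the value zero and powers of `p`, and the weights exceed `1/p`, so `ℤ_p^d`
is a ball of the deformed metric. Its images under powers of `A` are nested balls that shrink to
zero, since a limit ball of positive radius would be fixed by `A`. Hence digit sequences parametrise
`ℤ_p^d`, which gives `R = ρ(ℤ_p^d)`, of volume one by conservation of measure.

Shifting digits gives `ρ(Ax) = A⁻¹ρ(x)` on `ℤ_p^d`. Measuring `A ℤ_p^d` and its image yields `1/|D|
= 1/|det A|`. Digits distinct modulo `A ℤ_p^d` are distinct modulo `A ℤ^d`, which has index `|det
A|`, so `D` represents both quotients. Therefore `ℤ^d ∩ A ℤ_p^d = A ℤ^d`, so `p^k ℤ^d ⊆ A ℤ^d` for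
some `k`, and `det A` is a power of `p` up to sign.

For (B), positive volume of the compact set `R` forces `A⁻ⁿ → 0`, and then the integer translates of
`R` cover `ℝ^d`. A covering set has measure at least one. Since `R \ (R + k)` still covers, the part
removed from `R` is null. -/

open MeasureTheory Filter Topology
open scoped Pointwise

/-! ### The lattice `ℤ_p^d` and integer matrices -/

section PadicLattice

variable {p : ℕ} [Fact p.Prime] {d : ℕ}

theorem zero_mem_padicUnitBall : (0 : Fin d → ℚ_[p]) ∈ padicUnitBall p d := by
  simp [padicUnitBall]

theorem padicUnitBall_eq_closedBall : padicUnitBall p d = Metric.closedBall 0 1 := by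
  ext x; simp [padicUnitBall]

theorem isCompact_padicUnitBall : IsCompact (padicUnitBall p d) := by
  rw [padicUnitBall_eq_closedBall]; exact isCompact_closedBall 0 1

theorem add_mem_padicUnitBall {x y : Fin d → ℚ_[p]} (hx : x ∈ padicUnitBall p d)
    (hy : y ∈ padicUnitBall p d) : x + y ∈ padicUnitBall p d :=
  (IsUltrametricDist.norm_add_le_max x y).trans (max_le hx hy)

theorem vecCast_mem_padicUnitBall (n : Fin d → ℤ) : vecCast ℚ_[p] n ∈ padicUnitBall p d :=
  (pi_norm_le_iff_of_nonneg zero_le_one).2 fun l => Padic.norm_int_le_one (n l)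

theorem matCast_mulVec_mem_padicUnitBall (A : Matrix (Fin d) (Fin d) ℤ) {x : Fin d → ℚ_[p]}
    (hx : x ∈ padicUnitBall p d) : (matCast ℚ_[p] A).mulVec x ∈ padicUnitBall p d := by
  refine (pi_norm_le_iff_of_nonneg zero_le_one).2 fun i => ?_
  refine IsUltrametricDist.norm_sum_le_of_forall_le_of_nonneg (s := Finset.univ)
    (f := fun j => matCast ℚ_[p] A i j * x j) zero_le_one fun j _ => ?_
  rw [norm_mul]
  refine mul_le_one₀ ?_ (norm_nonneg _) ((norm_le_pi_norm x j).trans hx)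
  simpa [matCast] using Padic.norm_int_le_one (A i j)

theorem matCast_pow_mulVec_mem_padicUnitBall (A : Matrix (Fin d) (Fin d) ℤ) (n : ℕ)
    {x : Fin d → ℚ_[p]} (hx : x ∈ padicUnitBall p d) :
    (matCast ℚ_[p] A ^ n).mulVec x ∈ padicUnitBall p d := by
  induction n with
  | zero => simpa using hx
  | succ n ih =>
    rw [pow_succ', ← Matrix.mulVec_mulVec]
    exact matCast_mulVec_mem_padicUnitBall A ih

theorem det_matCast (K : Type*) [CommRing K] (A : Matrix (Fin d) (Fin d) ℤ) :
    (matCast K A).det = (A.det : K) := by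
  simpa [matCast] using (RingHom.map_det (Int.castRingHom K) A).symm

theorem vecCast_mulVec (K : Type*) [CommRing K] (A : Matrix (Fin d) (Fin d) ℤ) (n : Fin d → ℤ) :
    vecCast K (A.mulVec n) = (matCast K A).mulVec (vecCast K n) := by
  ext i; simp [vecCast, matCast, Matrix.mulVec, dotProduct]

theorem vecCast_sub (K : Type*) [Ring K] (m n : Fin d → ℤ) :
    vecCast K (m - n) = vecCast K m - vecCast K n := by
  ext i; simp [vecCast]

theorem vecCast_zero (K : Type*) [Ring K] : vecCast K (0 : Fin d → ℤ) = 0 := by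
  ext i; simp [vecCast]

variable {δ : (Fin d → ℚ_[p]) → (Fin d → ℚ_[p]) → ℝ} {A : Matrix (Fin d) (Fin d) ℤ}
  {D : Finset (Fin d → ℤ)}

/-! ### Deformed metrics and dilations -/

theorem IsDeformedMetric.le_of_norm_le (hδ : IsDeformedMetric δ) {x : Fin d → ℚ_[p]} {r : ℝ}
    (hx : ‖x‖ ≤ r) : δ x 0 ≤ r := by
  obtain ⟨q, U, hq, h⟩ := hδ
  have hr := (norm_nonneg x).trans hx
  rw [h]
  refine Real.iSup_le (fun l => ?_) hr
  have h1 := norm_le_pi_norm (U x) l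
  rw [U.norm_map] at h1
  have h2 := hq l
  have h3 := norm_nonneg (U x l)
  simp only [map_zero, Pi.zero_apply, sub_zero]
  nlinarith

theorem IsDeformedMetric.norm_le_of_le (hδ : IsDeformedMetric δ) {x : Fin d → ℚ_[p]} {r : ℝ}
    (hr : 0 ≤ r) (hx : δ x 0 ≤ r) : ‖x‖ ≤ p * r := by
  obtain ⟨q, U, hq, h⟩ := hδ
  have hp : (0 : ℝ) < p := by exact_mod_cast (Fact.out : p.Prime).pos
  rw [h] at hx
  rw [← U.norm_map]
  refine (pi_norm_le_iff_of_nonneg (by positivity)).2 fun l => ?_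
  have h1 := (le_ciSup (f := fun l => q l * ‖U x l - U 0 l‖)
    (Set.finite_range _).bddAbove l).trans hx
  simp only [map_zero, Pi.zero_apply, sub_zero] at h1
  have h2 := mul_le_mul_of_nonneg_right (hq l).1.le (norm_nonneg (U x l))
  have h3 := h2.trans h1
  rwa [inv_mul_le_iff₀ hp] at h3

/-- A weight above `1/p` forces each coordinate norm below `p`, hence to at most one, because no
value of the norm lies strictly between `1` and `p`. -/
theorem IsDeformedMetric.le_one_iff (hδ : IsDeformedMetric δ) {x : Fin d → ℚ_[p]} :
    δ x 0 ≤ 1 ↔ ‖x‖ ≤ 1 := by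
  refine ⟨fun hx => ?_, hδ.le_of_norm_le⟩
  obtain ⟨q, U, hq, h⟩ := hδ
  have hp : (0 : ℝ) < p := by exact_mod_cast (Fact.out : p.Prime).pos
  rw [h] at hx
  rw [← U.norm_map]
  refine (pi_norm_le_iff_of_nonneg zero_le_one).2 fun l => ?_
  have h1 := (le_ciSup (f := fun l => q l * ‖U x l - U 0 l‖)
    (Set.finite_range _).bddAbove l).trans hx
  simp only [map_zero, Pi.zero_apply, sub_zero] at h1
  have h2 : ‖U x l‖ < (p : ℝ) ^ ((0 : ℤ) + 1) := by
    rcases (norm_nonneg (U x l)).eq_or_lt with h0 | h0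
    · rw [← h0]; positivity
    · have h3 := (mul_lt_mul_of_pos_right (hq l).1 h0).trans_le h1
      rw [inv_mul_lt_iff₀ hp] at h3
      simpa using h3
  simpa using (Padic.norm_le_pow_iff_norm_lt_pow_add_one _ _).2 h2

theorem isZeroBall_padicUnitBall (hδ : IsDeformedMetric δ) :
    IsZeroBall δ (padicUnitBall p d) :=
  ⟨1, one_pos, by ext x; exact hδ.le_one_iff.symm⟩

/-- The image of `ℤ_p^d` is again a ball of positive radius, and a subspace with non-empty interior
is everything. -/
theorem IsDilation.det_ne_zero (hδ : IsDeformedMetric δ)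
    (hA : IsDilation δ (Matrix.mulVecLin (matCast ℚ_[p] A))) : A.det ≠ 0 := by
  obtain ⟨⟨r, hr, hB⟩, -⟩ := hA _ (isZeroBall_padicUnitBall hδ)
  have htop : LinearMap.range (Matrix.mulVecLin (matCast ℚ_[p] A)) = ⊤ := by
    refine Submodule.eq_top_of_nonempty_interior' _ ⟨0, mem_interior.2
      ⟨Metric.ball 0 r, fun x hx => ?_, Metric.isOpen_ball, by simpa using hr⟩⟩
    have hx' : ‖x‖ ≤ r := by
      have := Metric.mem_ball.1 hx
      rw [dist_zero_right] at this
      exact this.le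
    have : x ∈ (Matrix.mulVecLin (matCast ℚ_[p] A)) '' padicUnitBall p d := by
      rw [hB]; exact hδ.le_of_norm_le hx'
    obtain ⟨y, -, hy⟩ := this
    exact ⟨y, hy⟩
  have hinj := LinearMap.injective_iff_surjective.2 (LinearMap.range_eq_top.1 htop)
  have hu : IsUnit (matCast ℚ_[p] A) := Matrix.mulVec_injective_iff_isUnit.1 hinj
  rw [Matrix.isUnit_iff_isUnit_det, det_matCast] at hu
  intro h0
  simp [h0] at hu

theorem mulVec_matCast_injective {K : Type*} [Field K] [CharZero K] (hA : A.det ≠ 0) :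
    Function.Injective (matCast K A).mulVec := by
  rw [Matrix.mulVec_injective_iff_isUnit, Matrix.isUnit_iff_isUnit_det, det_matCast]
  exact (Int.cast_ne_zero.2 hA).isUnit

/-- The iterates of a dilation shrink the unit ball to zero. -/
theorem IsDilation.exists_pow_norm_le (hδ : IsDeformedMetric δ)
    (hA : IsDilation δ (Matrix.mulVecLin (matCast ℚ_[p] A))) {ε : ℝ} (hε : 0 < ε) :
    ∃ n : ℕ, ∀ x ∈ padicUnitBall p d, ‖(matCast ℚ_[p] A ^ n).mulVec x‖ ≤ ε := by
  set M := matCast ℚ_[p] A with hM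
  have hp : (0 : ℝ) < p := by exact_mod_cast (Fact.out : p.Prime).pos
  have hball : ∀ n : ℕ, IsZeroBall δ ((M ^ n).mulVec '' padicUnitBall p d) := by
    intro n
    induction n with
    | zero => simpa using isZeroBall_padicUnitBall hδ
    | succ n ih =>
      convert (hA _ ih).1 using 1
      rw [Set.image_image]
      refine Set.image_congr' fun x => ?_
      rw [pow_succ', ← Matrix.mulVec_mulVec]; rfl
  choose r hr hB using hball
  by_contra! hcon
  have hrε : ∀ n, ε / p ≤ r n := by
    intro n
    by_contra! hlt
    obtain ⟨x, hx, hxε⟩ := hcon n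
    have hx' : δ ((M ^ n).mulVec x) 0 ≤ r n := by
      have := Set.mem_image_of_mem (M ^ n).mulVec hx
      rw [hB n] at this
      exact this
    have h1 := hδ.norm_le_of_le (div_pos hε hp).le (hx'.trans hlt.le)
    rw [mul_div_cancel₀ _ hp.ne'] at h1
    exact absurd h1 (not_le.2 hxε)
  have hbdd : BddBelow (Set.range r) := ⟨ε / p, by rintro _ ⟨n, rfl⟩; exact hrε n⟩
  -- With radii bounded away from zero, the intersection of all the images is itself a ball. It is
  -- contained in its own image under `A`, which contradicts that a dilation maps a ball to a proper
  -- subball.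
  set K : Set (Fin d → ℚ_[p]) := ⋂ n, (M ^ n).mulVec '' padicUnitBall p d with hK
  have hKball : IsZeroBall δ K := by
    refine ⟨⨅ n, r n, (div_pos hε hp).trans_le (le_ciInf hrε), ?_⟩
    ext x
    simp only [hK, Set.mem_iInter, Set.mem_ofPred_eq, le_ciInf_iff hbdd, hB]
  refine (hA K hKball).2.1.not_subset fun x hx => ?_
  have hx' := Set.mem_iInter.1 hx
  obtain ⟨y, -, hy⟩ := hx' 1
  rw [pow_one] at hy
  refine ⟨y, Set.mem_iInter.2 fun n => ?_, hy⟩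
  obtain ⟨z, hz, hzx⟩ := hx' (n + 1)
  rw [← hy, pow_succ', ← Matrix.mulVec_mulVec] at hzx
  exact ⟨z, hz, mulVec_matCast_injective (IsDilation.det_ne_zero hδ hA) hzx⟩

/-- The powers of `A` contract the lattice `ℤ_p^d` to zero. -/
def IsPadicContraction (p : ℕ) [Fact p.Prime] {d : ℕ} (A : Matrix (Fin d) (Fin d) ℤ) : Prop :=
  ∀ ε : ℝ, 0 < ε → ∃ n : ℕ, ∀ x ∈ padicUnitBall p d, ‖(matCast ℚ_[p] A ^ n).mulVec x‖ ≤ ε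

theorem IsPadicContraction.tendsto (hA : IsPadicContraction p A) {v : ℕ → Fin d → ℚ_[p]}
    (hv : ∀ i, v i ∈ padicUnitBall p d) :
    Tendsto (fun i => (matCast ℚ_[p] A ^ i).mulVec (v i)) atTop (𝓝 0) := by
  rw [NormedAddGroup.tendsto_nhds_zero]
  intro ε hε
  obtain ⟨n, hn⟩ := hA (ε / 2) (half_pos hε)
  filter_upwards [eventually_ge_atTop n] with i hi
  obtain ⟨k, rfl⟩ := Nat.exists_eq_add_of_le hi
  rw [pow_add, ← Matrix.mulVec_mulVec]
  exact (hn _ (matCast_pow_mulVec_mem_padicUnitBall A k (hv _))).trans_lt (half_lt_self hε)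

/-! ### Digit expansions -/

/-- `x = ∑_{i ≥ 0} A^i c_i`. -/
def IsIntegralExpansion (p : ℕ) [Fact p.Prime] {d : ℕ} (A : Matrix (Fin d) (Fin d) ℤ)
    (x : Fin d → ℚ_[p]) (c : ℕ → Fin d → ℤ) : Prop :=
  HasSum (fun i : ℕ => (matCast ℚ_[p] A ^ i).mulVec (vecCast ℚ_[p] (c i))) x

theorem IsPadicContraction.exists_isIntegralExpansion (hA : IsPadicContraction p A)
    (c : ℕ → Fin d → ℤ) : ∃ x, IsIntegralExpansion p A x c := by
  refine ⟨_, (NonarchimedeanAddGroup.summable_of_tendsto_cofinite_zero ?_).hasSum⟩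
  rw [Nat.cofinite_eq_atTop]
  exact hA.tendsto fun i => vecCast_mem_padicUnitBall (c i)

theorem IsIntegralExpansion.mem {x : Fin d → ℚ_[p]} {c : ℕ → Fin d → ℤ}
    (h : IsIntegralExpansion p A x c) : x ∈ padicUnitBall p d := by
  refine isCompact_padicUnitBall.isClosed.mem_of_tendsto h (Eventually.of_forall fun s => ?_)
  induction s using Finset.cons_induction with
  | empty => simpa using zero_mem_padicUnitBall
  | cons i s hi ih =>
    rw [Finset.sum_cons]
    exact add_mem_padicUnitBall
      (matCast_pow_mulVec_mem_padicUnitBall A i (vecCast_mem_padicUnitBall _)) ih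

theorem IsIntegralExpansion.cons {x : Fin d → ℚ_[p]} {c : ℕ → Fin d → ℤ}
    (h : IsIntegralExpansion p A x fun i => c (i + 1)) :
    IsIntegralExpansion p A (vecCast ℚ_[p] (c 0) + (matCast ℚ_[p] A).mulVec x) c := by
  have h1 := h.map (Matrix.mulVecLin (matCast ℚ_[p] A))
    (LinearMap.continuous_of_finiteDimensional _)
  have h2 : HasSum (fun i : ℕ => (matCast ℚ_[p] A ^ (i + 1)).mulVec (vecCast ℚ_[p] (c (i + 1))))
      ((matCast ℚ_[p] A).mulVec x) := by
    refine h1.congr_fun fun i => ?_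
    simp [pow_succ', Matrix.mulVec_mulVec]
  have h3 := (hasSum_nat_add_iff (f := fun i : ℕ =>
    (matCast ℚ_[p] A ^ i).mulVec (vecCast ℚ_[p] (c i))) 1).1 h2
  unfold IsIntegralExpansion
  rw [Finset.sum_range_one, pow_zero, Matrix.one_mulVec, add_comm] at h3
  exact h3

theorem IsPadicContraction.exists_tail (hA : IsPadicContraction p A) {x : Fin d → ℚ_[p]}
    {c : ℕ → Fin d → ℤ} (h : IsIntegralExpansion p A x c) :
    ∃ y, IsIntegralExpansion p A y (fun i => c (i + 1)) ∧
      x = vecCast ℚ_[p] (c 0) + (matCast ℚ_[p] A).mulVec y := by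
  obtain ⟨y, hy⟩ := hA.exists_isIntegralExpansion fun i => c (i + 1)
  exact ⟨y, hy, h.unique hy.cons⟩

/-- The class modulo `A ℤ_p^d` determines the digit at zero; cancelling `A` passes to the tails. -/
theorem IsPadicContraction.isIntegralExpansion_unique (hA : IsPadicContraction p A)
    (hdet : A.det ≠ 0) (hD : IsPadicDigitSet p A D) (n : ℕ) :
    ∀ {x : Fin d → ℚ_[p]} {c c' : ℕ → Fin d → ℤ}, (∀ i, c i ∈ D) → (∀ i, c' i ∈ D) →
      IsIntegralExpansion p A x c → IsIntegralExpansion p A x c' → c n = c' n := by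
  have key : ∀ {x : Fin d → ℚ_[p]} {c c' : ℕ → Fin d → ℤ}, (∀ i, c i ∈ D) → (∀ i, c' i ∈ D) →
      IsIntegralExpansion p A x c → IsIntegralExpansion p A x c' → c 0 = c' 0 ∧
      ∃ y, IsIntegralExpansion p A y (fun i => c (i + 1)) ∧
        IsIntegralExpansion p A y (fun i => c' (i + 1)) := by
    intro x c c' hc hc' h h'
    obtain ⟨y, hy, hxy⟩ := hA.exists_tail h
    obtain ⟨y', hy', hxy'⟩ := hA.exists_tail h'
    have h0 : c 0 = c' 0 := (hD x h.mem).unique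
      ⟨hc 0, y, hy.mem, by rw [hxy]; simp⟩ ⟨hc' 0, y', hy'.mem, by rw [hxy']; simp⟩
    refine ⟨h0, y, hy, ?_⟩
    have : y = y' := mulVec_matCast_injective hdet (by
      rw [h0] at hxy
      exact add_left_cancel (hxy.symm.trans hxy'))
    rwa [this]
  induction n with
  | zero => exact fun hc hc' h h' => (key hc hc' h h').1
  | succ n ih =>
    intro x c c' hc hc' h h'
    obtain ⟨-, y, hy, hy'⟩ := key hc hc' h h'
    exact ih (fun i => hc (i + 1)) (fun i => hc' (i + 1)) hy hy'

theorem IsPadicContraction.exists_digits (hA : IsPadicContraction p A)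
    (hD : IsPadicDigitSet p A D) {x : Fin d → ℚ_[p]} (hx : x ∈ padicUnitBall p d) :
    ∃ c : ℕ → Fin d → ℤ, (∀ i, c i ∈ D) ∧ IsIntegralExpansion p A x c := by
  have step : ∀ z : padicUnitBall p d, ∃ n ∈ D, ∃ y : padicUnitBall p d,
      (z : Fin d → ℚ_[p]) = vecCast ℚ_[p] n + (matCast ℚ_[p] A).mulVec y := by
    rintro ⟨z, hz⟩
    obtain ⟨n, ⟨hn, y, hy, h⟩, -⟩ := hD z hz
    exact ⟨n, hn, ⟨y, hy⟩, by rw [← h]; simp⟩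
  choose g hg t ht using step
  set X : ℕ → padicUnitBall p d := fun n => t^[n] ⟨x, hx⟩ with hX
  refine ⟨fun i => g (X i), fun i => hg _, ?_⟩
  obtain ⟨y, hy⟩ := hA.exists_isIntegralExpansion fun i => g (X i)
  -- Division with remainder, iterated: the error after `n` digits is `A^n` applied to a lattice
  -- point, which tends to zero.
  have hpart : ∀ n, ∑ i ∈ Finset.range n,
      (matCast ℚ_[p] A ^ i).mulVec (vecCast ℚ_[p] (g (X i))) =
        x - (matCast ℚ_[p] A ^ n).mulVec (X n) := by
    intro n
    induction n with
    | zero => simp [hX]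
    | succ n ih =>
      have hs : X (n + 1) = t (X n) := Function.iterate_succ_apply' _ _ _
      rw [Finset.sum_range_succ, ih, hs]
      conv_lhs => rw [ht (X n)]
      rw [Matrix.mulVec_add, pow_succ, ← Matrix.mulVec_mulVec]
      abel
  have h1 := hy.tendsto_sum_nat
  simp only [hpart] at h1
  have h2 := (hA.tendsto fun i => (X i).2).const_sub x
  rw [sub_zero] at h2
  rwa [← tendsto_nhds_unique h1 h2]

/-- A sequence indexed by `ℕ`, continued by zero to `ℤ`. -/
def extendZero (c : ℕ → Fin d → ℤ) (i : ℤ) : Fin d → ℤ := if 0 ≤ i then c i.toNat else 0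

theorem extendZero_natCast (c : ℕ → Fin d → ℤ) (i : ℕ) : extendZero c i = c i := by
  simp [extendZero]

theorem isDigitSeq_extendZero (hD0 : (0 : Fin d → ℤ) ∈ D) {c : ℕ → Fin d → ℤ}
    (hc : ∀ i, c i ∈ D) : IsDigitSeq D (extendZero c) := by
  refine ⟨fun i => ?_, 0, fun i hi => ?_⟩
  · unfold extendZero
    split_ifs
    exacts [hc _, hD0]
  · simp [extendZero, not_le.2 hi]

theorem hasSum_int_iff_nat {α : Type*} [AddCommMonoid α] [TopologicalSpace α] {f : ℤ → α}
    (hf : ∀ i < 0, f i = 0) {a : α} : HasSum f a ↔ HasSum (fun i : ℕ => f i) a :=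
  (Function.Injective.hasSum_iff Nat.cast_injective fun i hi => hf i (by
    by_contra! h
    exact hi ⟨i.toNat, by simpa using h⟩)).symm

theorem isPadicExpansion_extendZero (hD0 : (0 : Fin d → ℤ) ∈ D) {c : ℕ → Fin d → ℤ}
    (hc : ∀ i, c i ∈ D) {x : Fin d → ℚ_[p]} (h : IsIntegralExpansion p A x c) :
    IsPadicExpansion p A D x (extendZero c) := by
  refine ⟨isDigitSeq_extendZero hD0 hc, (hasSum_int_iff_nat fun i hi => ?_).2 ?_⟩
  · simp [extendZero, not_le.2 hi, vecCast_zero]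
  · simp only [extendZero_natCast, zpow_natCast]
    exact h

/-- Multiplying by a large power of `A` reduces uniqueness in `ℚ_p^d` to uniqueness in `ℤ_p^d`. -/
theorem isIntegralExpansion_shift (hdet : A.det ≠ 0) {x : Fin d → ℚ_[p]} {c : ℤ → Fin d → ℤ}
    (h : IsPadicExpansion p A D x c) {n : ℕ} (hn : ∀ i : ℤ, i < -n → c i = 0) :
    IsIntegralExpansion p A ((matCast ℚ_[p] A ^ n).mulVec x) fun i => c (i - n) := by
  have hu : IsUnit (matCast ℚ_[p] A).det := by
    rw [det_matCast]; exact (Int.cast_ne_zero.2 hdet).isUnit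
  have h1 := h.2.map (Matrix.mulVecLin (matCast ℚ_[p] A ^ n))
    (LinearMap.continuous_of_finiteDimensional _)
  rw [← (Equiv.subRight (n : ℤ)).hasSum_iff, hasSum_int_iff_nat] at h1
  · unfold IsIntegralExpansion
    refine h1.congr_fun fun i => ?_
    simp only [Function.comp_apply, Equiv.subRight_apply, Matrix.mulVecLin_apply,
      Matrix.mulVec_mulVec]
    rw [← zpow_natCast (matCast ℚ_[p] A) n, ← Matrix.zpow_add hu, add_sub_cancel, zpow_natCast]
  · intro i hi
    simp [hn (i - n) (by omega), vecCast_zero]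

theorem IsPadicContraction.isPadicExpansion_unique (hA : IsPadicContraction p A)
    (hdet : A.det ≠ 0) (hD : IsPadicDigitSet p A D) {x : Fin d → ℚ_[p]} {c c' : ℤ → Fin d → ℤ}
    (h : IsPadicExpansion p A D x c) (h' : IsPadicExpansion p A D x c') : c = c' := by
  obtain ⟨g, hg⟩ := h.1.2
  obtain ⟨g', hg'⟩ := h'.1.2
  set n : ℕ := g.natAbs + g'.natAbs with hn
  have e := isIntegralExpansion_shift hdet h (n := n) fun i hi => hg i (by omega)
  have e' := isIntegralExpansion_shift hdet h' (n := n) fun i hi => hg' i (by omega)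
  ext1 i
  by_cases hi : i < -n
  · rw [hg i (by omega), hg' i (by omega)]
  · have := hA.isIntegralExpansion_unique hdet hD (i + n).toNat (fun j => h.1.1 _)
      (fun j => h'.1.1 _) e e'
    have hi' : ((i + n).toNat : ℤ) - n = i := by omega
    simpa only [hi'] using this

theorem IsPadicContraction.padicDigits_eq (hA : IsPadicContraction p A)
    (hdet : A.det ≠ 0) (hD : IsPadicDigitSet p A D) (hD0 : (0 : Fin d → ℤ) ∈ D)
    {c : ℕ → Fin d → ℤ} (hc : ∀ i, c i ∈ D) {x : Fin d → ℚ_[p]}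
    (h : IsIntegralExpansion p A x c) : padicDigits p A D x = extendZero c := by
  have hx : ∃ c, IsPadicExpansion p A D x c := ⟨_, isPadicExpansion_extendZero hD0 hc h⟩
  unfold padicDigits
  rw [dif_pos hx]
  exact hA.isPadicExpansion_unique hdet hD hx.choose_spec (isPadicExpansion_extendZero hD0 hc h)

end PadicLattice

/-! ### The real tile: compactness and contraction by the inverse matrix -/

section RealTile

variable {d : ℕ} {A : Matrix (Fin d) (Fin d) ℤ} {D : Finset (Fin d → ℤ)}

/-- The `i`-th term of the series that defines `realTile`. -/
noncomputable def tileTerm (A : Matrix (Fin d) (Fin d) ℤ) (c : ℕ → Fin d → ℤ) (i : ℕ) : Fin d → ℝ :=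
  ((matCast ℝ A)⁻¹ ^ (i + 1)).mulVec (vecCast ℝ (c i))

theorem realTerm_extendZero (c : ℕ → Fin d → ℤ) (i : ℕ) :
    realTerm A (extendZero c) i = tileTerm A c i := by
  have h : -(i : ℤ) - 1 = -((i + 1 : ℕ) : ℤ) := by push_cast; ring
  rw [realTerm, tileTerm, extendZero_natCast, h, Matrix.zpow_neg_natCast, Matrix.inv_pow']

theorem realTerm_extendZero_of_neg (c : ℕ → Fin d → ℤ) {i : ℤ} (hi : i < 0) :
    realTerm A (extendZero c) i = 0 := by
  simp [realTerm, extendZero, not_le.2 hi, vecCast_zero]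

theorem RealSeriesConverge.summable_tileTerm (hconv : RealSeriesConverge A D)
    (hD0 : (0 : Fin d → ℤ) ∈ D) {c : ℕ → Fin d → ℤ} (hc : ∀ i, c i ∈ D) :
    Summable (tileTerm A c) := by
  obtain ⟨a, ha⟩ := hconv _ (isDigitSeq_extendZero hD0 hc)
  rw [hasSum_int_iff_nat fun i hi => realTerm_extendZero_of_neg c hi] at ha
  simp only [realTerm_extendZero] at ha
  exact ⟨a, ha⟩

/-- At each index pick the digit whose term is largest. These digits form an admissible sequence,
whose series converges absolutely in finite dimension. -/
theorem RealSeriesConverge.exists_summable_bound (hconv : RealSeriesConverge A D)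
    (hD0 : (0 : Fin d → ℤ) ∈ D) : ∃ b : ℕ → ℝ, Summable b ∧
      ∀ c : ℕ → Fin d → ℤ, (∀ i, c i ∈ D) → ∀ i, ‖tileTerm A c i‖ ≤ b i := by
  choose m hm hmax using fun i : ℕ => Finset.exists_max_image D
    (fun n => ‖((matCast ℝ A)⁻¹ ^ (i + 1)).mulVec (vecCast ℝ n)‖) ⟨0, hD0⟩
  exact ⟨_, (hconv.summable_tileTerm hD0 hm).norm, fun c hc i => hmax i (c i) (hc i)⟩

/-- The uniform bound makes the tile a continuous image of the compact product of copies of `D`. -/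
theorem RealSeriesConverge.isCompact_realTile (hconv : RealSeriesConverge A D)
    (hD0 : (0 : Fin d → ℤ) ∈ D) : IsCompact (realTile A D) := by
  obtain ⟨b, hb, hbound⟩ := hconv.exists_summable_bound hD0
  have hcont : Continuous fun c : ℕ → D => ∑' i, tileTerm A (fun i => c i) i := by
    refine continuous_tsum (fun i => ?_) hb fun i c => hbound _ (fun i => (c i).2) i
    exact (continuous_of_discreteTopology (f := fun n : D =>
      ((matCast ℝ A)⁻¹ ^ (i + 1)).mulVec (vecCast ℝ (n : Fin d → ℤ)))).comp (continuous_apply i)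
  convert isCompact_range hcont
  ext y
  constructor
  · rintro ⟨c, hc, h⟩
    exact ⟨fun i => ⟨c i, hc i⟩, h.tsum_eq⟩
  · rintro ⟨c, rfl⟩
    exact ⟨fun i => c i, fun i => (c i).2,
      (hconv.summable_tileTerm hD0 fun i => (c i).2).hasSum⟩

theorem hasSum_tileTerm_cons {c : ℕ → Fin d → ℤ} {y : Fin d → ℝ}
    (h : HasSum (tileTerm A fun i => c (i + 1)) y) :
    HasSum (tileTerm A c) ((matCast ℝ A)⁻¹.mulVec (y + vecCast ℝ (c 0))) := by
  have h1 : HasSum (fun i => tileTerm A c (i + 1)) ((matCast ℝ A)⁻¹.mulVec y) :=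
    (h.map (Matrix.mulVecLin (matCast ℝ A)⁻¹)
      (LinearMap.continuous_of_finiteDimensional _)).congr_fun fun i => by
        simp [tileTerm, pow_succ' _ (i + 1), Matrix.mulVec_mulVec]
  have h2 := (hasSum_nat_add_iff (f := tileTerm A c) 1).1 h1
  rw [Finset.sum_range_one] at h2
  simpa [Matrix.mulVec_add, tileTerm] using h2

theorem inv_mulVec_add_mem_realTile {y : Fin d → ℝ} (hy : y ∈ realTile A D) {n : Fin d → ℤ}
    (hn : n ∈ D) : (matCast ℝ A)⁻¹.mulVec (y + vecCast ℝ n) ∈ realTile A D := by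
  obtain ⟨c, hc, h⟩ := hy
  let c' : ℕ → Fin d → ℤ := fun i => if i = 0 then n else c (i - 1)
  have h' : HasSum (tileTerm A fun i => c' (i + 1)) y := by
    have e : (fun i => c' (i + 1)) = c := by ext1 i; simp [c']
    rw [e]
    exact h
  refine ⟨c', fun i => ?_, hasSum_tileTerm_cons h'⟩
  simp only [c']
  split_ifs
  exacts [hn, hc _]

/-- The vectors contracted to zero form a subspace. It contains the tile, and a proper subspace is
null. -/
theorem tendsto_inv_pow_mulVec (hconv : RealSeriesConverge A D) (hD0 : (0 : Fin d → ℤ) ∈ D)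
    (hvol : volume (realTile A D) ≠ 0) (v : Fin d → ℝ) :
    Tendsto (fun n : ℕ => ((matCast ℝ A)⁻¹ ^ n).mulVec v) atTop (𝓝 0) := by
  let W : Submodule ℝ (Fin d → ℝ) :=
    { carrier := {v | Tendsto (fun n : ℕ => ((matCast ℝ A)⁻¹ ^ n).mulVec v) atTop (𝓝 0)}
      add_mem' := fun {a b} ha hb => by
        simpa [Matrix.mulVec_add] using Tendsto.add (f := fun n : ℕ =>
          ((matCast ℝ A)⁻¹ ^ n).mulVec a) ha hb
      zero_mem' := by simp
      smul_mem' := fun r a ha => by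
        simpa [Matrix.mulVec_smul] using Tendsto.const_smul (f := fun n : ℕ =>
          ((matCast ℝ A)⁻¹ ^ n).mulVec a) ha r }
  have hsub : realTile A D ⊆ W := by
    rintro y ⟨c, hc, h⟩
    refine W.closed_of_finiteDimensional.mem_of_tendsto h
      (Eventually.of_forall fun s => W.sum_mem fun i _ => ?_)
    -- The series with constant digit `c i` has as its late terms the iterates of `A⁻¹` on the
    -- `i`-th term of `y`.
    have h1 := (hconv.summable_tileTerm hD0 fun _ => hc i).tendsto_atTop_zero
    have h2 := h1.comp (tendsto_add_atTop_nat i)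
    refine h2.congr fun n => ?_
    simp only [Function.comp_apply, tileTerm, Matrix.mulVec_mulVec, ← pow_add, add_assoc]
  have hW : W = ⊤ := by
    by_contra hne
    exact hvol (measure_mono_null hsub (Measure.addHaar_submodule volume W hne))
  exact (hW ▸ Submodule.mem_top : v ∈ W)

theorem tendsto_inv_pow_mulVec_of_bounded
    (hcontr : ∀ v, Tendsto (fun n : ℕ => ((matCast ℝ A)⁻¹ ^ n).mulVec v) atTop (𝓝 0))
    {u : ℕ → Fin d → ℝ} {C : ℝ} (hu : ∀ n, ‖u n‖ ≤ C) :
    Tendsto (fun n : ℕ => ((matCast ℝ A)⁻¹ ^ n).mulVec (u n)) atTop (𝓝 0) := by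
  have h1 : Tendsto (fun n : ℕ => ∑ j, u n j • ((matCast ℝ A)⁻¹ ^ n).mulVec (Pi.single j 1))
      atTop (𝓝 (∑ _j : Fin d, 0)) := by
    refine tendsto_finsetSum _ fun j _ => ?_
    exact (isBoundedUnder_of ⟨C, fun n => (norm_le_pi_norm (u n) j).trans (hu n)⟩
      ).smul_tendsto_zero (hcontr _)
  rw [Finset.sum_const_zero] at h1
  refine h1.congr fun n => ?_
  conv_rhs => rw [pi_eq_sum_univ' (u n)]
  simp [Matrix.mulVec_sum, Matrix.mulVec_smul]

/-! ### Covering and tiling by integer translates -/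

/-- The set of integer vectors in `ℝ^d`. -/
noncomputable def integerVectors (d : ℕ) : Set (Fin d → ℝ) := Set.range (vecCast ℝ)

theorem isClosed_integerVectors : IsClosed (integerVectors d) := by
  have h : integerVectors d = Set.univ.pi fun _ => Set.range ((↑) : ℤ → ℝ) := by
    ext x
    simp only [integerVectors, Set.mem_range, Set.mem_univ_pi]
    refine ⟨?_, fun h => ?_⟩
    · rintro ⟨n, rfl⟩ i
      exact ⟨n i, rfl⟩
    · choose n hn using h
      exact ⟨n, funext hn⟩
  rw [h]
  exact isClosed_set_pi fun _ _ => Int.isClosedEmbedding_coe_real.isClosed_range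

/-- The integer translates of the tile cover the space. -/
theorem exists_sub_mem_realTile (hconv : RealSeriesConverge A D) (hD0 : (0 : Fin d → ℤ) ∈ D)
    (hdet : A.det ≠ 0) (hD : IsIntegerDigitSet A D) (hvol : volume (realTile A D) ≠ 0)
    (y : Fin d → ℝ) : ∃ k : Fin d → ℤ, y - vecCast ℝ k ∈ realTile A D := by
  have hu : IsUnit (matCast ℝ A).det := by
    rw [det_matCast]; exact (Int.cast_ne_zero.2 hdet).isUnit
  set T : Set (Fin d → ℝ) := {y | ∃ k : Fin d → ℤ, y - vecCast ℝ k ∈ realTile A D} with hT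
  have hclosed : IsClosed T := by
    have : T = integerVectors d + realTile A D := by
      ext y
      simp only [hT, Set.mem_add, integerVectors]
      constructor
      · rintro ⟨k, hk⟩
        exact ⟨_, ⟨k, rfl⟩, _, hk, by simp⟩
      · rintro ⟨_, ⟨k, rfl⟩, r, hr, rfl⟩
        exact ⟨k, by simpa using hr⟩
    rw [this]
    exact isClosed_integerVectors.add_right_of_isCompact (hconv.isCompact_realTile hD0)
  -- If `n` is the digit congruent to `k` and `k - n = A w`, then `A⁻¹ y - w = A⁻¹ (y - k + n)`, a
  -- tile point with one more digit.
  have hinv : ∀ y ∈ T, (matCast ℝ A)⁻¹.mulVec y ∈ T := by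
    rintro y ⟨k, hk⟩
    obtain ⟨n, ⟨hn, w, hw⟩, -⟩ := hD k
    refine ⟨w, ?_⟩
    convert inv_mulVec_add_mem_realTile hk hn using 1
    have h1 : y - vecCast ℝ k + vecCast ℝ n = y - (matCast ℝ A).mulVec (vecCast ℝ w) := by
      rw [← vecCast_mulVec, ← hw, vecCast_sub]; abel
    rw [h1, Matrix.mulVec_sub, Matrix.mulVec_mulVec, Matrix.nonsing_inv_mul _ hu,
      Matrix.one_mulVec]
  have hinv' : ∀ n : ℕ, ∀ y ∈ T, ((matCast ℝ A)⁻¹ ^ n).mulVec y ∈ T := by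
    intro n
    induction n with
    | zero => simp
    | succ n ih =>
      intro y hy
      rw [pow_succ', ← Matrix.mulVec_mulVec]
      exact hinv _ (ih y hy)
  obtain ⟨r, hr⟩ : (realTile A D).Nonempty := nonempty_of_measure_ne_zero hvol
  -- Rounding `A^n y` gives a point `r + z n` of `T` at bounded distance from it. Applying `A⁻ⁿ`
  -- yields points of `T` converging to `y`.
  let z : ℕ → Fin d → ℤ := fun n i => ⌊((matCast ℝ A ^ n).mulVec y) i⌋
  let u : ℕ → Fin d → ℝ := fun n => r + vecCast ℝ (z n) - (matCast ℝ A ^ n).mulVec y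
  have hub : ∀ n, ‖u n‖ ≤ ‖r‖ + 1 := by
    intro n
    have : u n = r - ((matCast ℝ A ^ n).mulVec y - vecCast ℝ (z n)) := by simp only [u]; abel
    rw [this]
    refine (norm_sub_le _ _).trans (add_le_add_right ?_ _)
    refine (pi_norm_le_iff_of_nonneg zero_le_one).2 fun i => ?_
    rw [Real.norm_eq_abs]
    change |_ - (⌊_⌋ : ℝ)| ≤ 1
    rw [Int.self_sub_floor, abs_of_nonneg (Int.fract_nonneg _)]
    exact (Int.fract_lt_one _).le
  have hlim := (tendsto_inv_pow_mulVec_of_bounded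
    (tendsto_inv_pow_mulVec hconv hD0 hvol) hub).const_add y
  rw [add_zero] at hlim
  refine hclosed.mem_of_tendsto hlim (Eventually.of_forall fun n => ?_)
  have h1 : y + ((matCast ℝ A)⁻¹ ^ n).mulVec (u n) =
      ((matCast ℝ A)⁻¹ ^ n).mulVec (r + vecCast ℝ (z n)) := by
    have hun : IsUnit (matCast ℝ A ^ n).det := by rw [Matrix.det_pow]; exact hu.pow n
    simp only [u]
    rw [Matrix.mulVec_sub _ (r + _), Matrix.mulVec_mulVec, Matrix.inv_pow',
      Matrix.nonsing_inv_mul _ hun, Matrix.one_mulVec]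
    abel
  rw [h1]
  exact hinv' n _ ⟨z n, by simpa using hr⟩

theorem vecCast_injective : Function.Injective (vecCast ℝ : (Fin d → ℤ) → Fin d → ℝ) :=
  fun _ _ h => funext fun i => Int.cast_injective (congrFun h i)

/-- A set whose integer translates cover `ℝ^d` has measure at least one. -/
theorem one_le_volume_of_cover {S : Set (Fin d → ℝ)}
    (hS : ∀ y, ∃ k : Fin d → ℤ, y - vecCast ℝ k ∈ S) : 1 ≤ volume S := by
  set b := Pi.basisFun ℝ (Fin d) with hb
  have hF := ZSpan.isAddFundamentalDomain' b volume
  have : Countable (Submodule.span ℤ (Set.range b)).toAddSubgroup :=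
    inferInstanceAs (Countable (Submodule.span ℤ (Set.range b)))
  have hmem : ∀ k : Fin d → ℤ, vecCast ℝ k ∈ Submodule.span ℤ (Set.range b) := by
    intro k
    refine (b.mem_span_iff_repr_mem ℤ _).2 fun i => ?_
    exact ⟨k i, by simp [hb, vecCast]⟩
  have h1 : volume (ZSpan.fundamentalDomain b) = 1 := by
    rw [hb, ZSpan.fundamentalDomain_pi_basisFun, Real.volume_pi_Ico]
    simp
  -- Cut `S` along the translates of the unit cube; the pieces, moved back, cover the cube.
  rw [← h1, hF.measure_eq_tsum S]
  refine (measure_mono fun y hy => ?_).trans (measure_iUnion_le _)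
  obtain ⟨k, hk⟩ := hS y
  refine Set.mem_iUnion.2 ⟨⟨_, hmem k⟩, ?_, hy⟩
  exact ⟨_, hk, add_sub_cancel (vecCast ℝ k) y⟩

/-- A compact set of measure one whose integer translates cover `ℝ^d` tiles. -/
theorem volume_inter_translate_eq_zero {S : Set (Fin d → ℝ)} (hc : IsCompact S)
    (hS : ∀ y, ∃ k : Fin d → ℤ, y - vecCast ℝ k ∈ S) (h1 : volume S = 1)
    {k : Fin d → ℤ} (hk : k ≠ 0) : volume (S ∩ (fun y => y + vecCast ℝ k) '' S) = 0 := by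
  set S' := (fun y => y + vecCast ℝ k) '' S with hS'
  have hc' : IsCompact S' := hc.image (continuous_id.add continuous_const)
  -- Otherwise every point of `S` congruent to some `y` also lies in `S + k`, so subtracting `k`
  -- never leaves `S`, against boundedness.
  have hcov : ∀ y, ∃ m : Fin d → ℤ, y - vecCast ℝ m ∈ S \ S' := by
    by_contra! hcon
    obtain ⟨y, hy⟩ := hcon
    obtain ⟨m, hm⟩ := hS y
    have hstep : ∀ n : ℕ, y - vecCast ℝ m - (n : ℝ) • vecCast ℝ k ∈ S := by
      intro n
      induction n with
      | zero => simpa using hm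
      | succ n ih =>
        have h2 : y - vecCast ℝ m - (n : ℝ) • vecCast ℝ k = y - vecCast ℝ (m + (n : ℤ) • k) := by
          ext i; simp [vecCast]; ring
        have h3 := hy (m + (n : ℤ) • k)
        rw [← h2] at h3
        obtain ⟨w, hw, hwe⟩ : _ ∈ S' := by
          by_contra h4
          exact h3 ⟨ih, h4⟩
        have : y - vecCast ℝ m - ((n + 1 : ℕ) : ℝ) • vecCast ℝ k = w := by
          rw [← eq_sub_iff_add_eq] at hwe
          rw [hwe]
          push_cast
          rw [add_smul, one_smul]; abel
        rwa [this]
    obtain ⟨C, hC⟩ := hc.isBounded.exists_norm_le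
    have hkpos : 0 < ‖vecCast ℝ k‖ := norm_pos_iff.2 fun h0 =>
      hk (vecCast_injective (h0.trans (vecCast_zero ℝ).symm))
    obtain ⟨n, hn⟩ := exists_nat_gt ((C + ‖y - vecCast ℝ m‖) / ‖vecCast ℝ k‖)
    rw [div_lt_iff₀ hkpos] at hn
    have h5 := hC _ (hstep n)
    have h6 := norm_sub_norm_le ((n : ℝ) • vecCast ℝ k) (y - vecCast ℝ m)
    rw [norm_sub_rev ((n : ℝ) • _), norm_smul, Real.norm_natCast] at h6
    linarith
  have h2 := one_le_volume_of_cover hcov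
  have h3 := measure_inter_add_sdiff (μ := volume) S hc'.isClosed.measurableSet
  rw [h1] at h3
  have hfin : volume (S \ S') ≠ ⊤ :=
    ((measure_mono Set.sdiff_subset).trans_lt (h1 ▸ ENNReal.one_lt_top)).ne
  have h4 : volume (S ∩ S') + volume (S \ S') ≤ 0 + volume (S \ S') := by
    rw [h3, zero_add]; exact h2
  exact nonpos_iff_eq_zero.1 ((ENNReal.add_le_add_iff_right hfin).1 h4)

end RealTile

/-! ### Conservation of measure and the determinant -/

section Conservation

variable {p : ℕ} [Fact p.Prime] {d : ℕ} {A : Matrix (Fin d) (Fin d) ℤ}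
  {D : Finset (Fin d → ℤ)}

theorem IsPadicContraction.rho_eq (hA : IsPadicContraction p A)
    (hdet : A.det ≠ 0) (hD : IsPadicDigitSet p A D) (hD0 : (0 : Fin d → ℤ) ∈ D)
    {c : ℕ → Fin d → ℤ} (hc : ∀ i, c i ∈ D) {x : Fin d → ℚ_[p]}
    (h : IsIntegralExpansion p A x c) {y : Fin d → ℝ} (hy : HasSum (tileTerm A c) y) :
    rho p A D x = y := by
  unfold rho
  rw [hA.padicDigits_eq hdet hD hD0 hc h]
  refine HasSum.tsum_eq ((hasSum_int_iff_nat fun i hi => realTerm_extendZero_of_neg c hi).2 ?_)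
  simpa only [realTerm_extendZero] using hy

theorem IsPadicContraction.realTile_eq (hA : IsPadicContraction p A)
    (hdet : A.det ≠ 0) (hD : IsPadicDigitSet p A D) (hD0 : (0 : Fin d → ℤ) ∈ D)
    (hconv : RealSeriesConverge A D) : realTile A D = rho p A D '' padicUnitBall p d := by
  ext y
  constructor
  · rintro ⟨c, hc, hy⟩
    obtain ⟨x, hx⟩ := hA.exists_isIntegralExpansion c
    exact ⟨x, hx.mem, hA.rho_eq hdet hD hD0 hc hx hy⟩
  · rintro ⟨x, hx, rfl⟩
    obtain ⟨c, hc, h⟩ := hA.exists_digits hD hx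
    have hs := (hconv.summable_tileTerm hD0 hc).hasSum
    rw [hA.rho_eq hdet hD hD0 hc h hs]
    exact ⟨c, hc, hs⟩

/-- The map `ρ` turns multiplication by `A` into multiplication by `A⁻¹`. -/
theorem IsPadicContraction.rho_mulVec (hA : IsPadicContraction p A)
    (hdet : A.det ≠ 0) (hD : IsPadicDigitSet p A D) (hD0 : (0 : Fin d → ℤ) ∈ D)
    (hconv : RealSeriesConverge A D) {x : Fin d → ℚ_[p]} (hx : x ∈ padicUnitBall p d) :
    rho p A D ((matCast ℚ_[p] A).mulVec x) = (matCast ℝ A)⁻¹.mulVec (rho p A D x) := by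
  obtain ⟨c, hc, h⟩ := hA.exists_digits hD hx
  have hs := (hconv.summable_tileTerm hD0 hc).hasSum
  -- Multiplication by `A` prepends the digit zero.
  let c' : ℕ → Fin d → ℤ := fun i => if i = 0 then 0 else c (i - 1)
  have e : (fun i => c' (i + 1)) = c := by ext1 i; simp [c']
  have e0 : c' 0 = 0 := by simp [c']
  have hc' : ∀ i, c' i ∈ D := by
    intro i
    simp only [c']
    split_ifs
    exacts [hD0, hc _]
  have h1 : IsIntegralExpansion p A ((matCast ℚ_[p] A).mulVec x) c' := by
    have := IsIntegralExpansion.cons (c := c') (x := x) (by rw [e]; exact h)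
    rwa [e0, vecCast_zero, zero_add] at this
  have h2 : HasSum (tileTerm A c') ((matCast ℝ A)⁻¹.mulVec (∑' i, tileTerm A c i)) := by
    have := hasSum_tileTerm_cons (c := c') (by rw [e]; exact hs)
    rwa [e0, vecCast_zero, add_zero] at this
  rw [hA.rho_eq hdet hD hD0 hc h hs, hA.rho_eq hdet hD hD0 hc' h1 h2]

instance padicHaar_isAddHaarMeasure : (padicHaar p d).IsAddHaarMeasure := by
  unfold padicHaar; infer_instance

theorem padicHaar_padicUnitBall : padicHaar p d (padicUnitBall p d) = 1 :=
  Measure.addHaarMeasure_self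

theorem isCompact_image_padicUnitBall :
    IsCompact ((matCast ℚ_[p] A).mulVec '' padicUnitBall p d) :=
  isCompact_padicUnitBall.image (Continuous.matrix_mulVec continuous_const continuous_id)

/-- The translates of `A ℤ_p^d` by the digits partition `ℤ_p^d`. -/
theorem IsPadicDigitSet.card_mul_padicHaar (hD : IsPadicDigitSet p A D) :
    (D.card : ENNReal) * padicHaar p d ((matCast ℚ_[p] A).mulVec '' padicUnitBall p d) = 1 := by
  set L := (matCast ℚ_[p] A).mulVec '' padicUnitBall p d with hL
  have hLm : MeasurableSet L := isCompact_image_padicUnitBall.isClosed.measurableSet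
  have hcover : padicUnitBall p d = ⋃ n ∈ D, (fun x => -vecCast ℚ_[p] n + x) ⁻¹' L := by
    ext x
    simp only [Set.mem_iUnion, Set.mem_preimage, exists_prop]
    constructor
    · intro hx
      obtain ⟨n, ⟨hn, y, hy, h⟩, -⟩ := hD x hx
      exact ⟨n, hn, y, hy, by rw [← h]; abel⟩
    · rintro ⟨n, -, y, hy, h⟩
      have : x = vecCast ℚ_[p] n + (matCast ℚ_[p] A).mulVec y := by rw [h]; abel
      rw [this]
      exact add_mem_padicUnitBall (vecCast_mem_padicUnitBall n)
        (matCast_mulVec_mem_padicUnitBall A hy)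
  rw [← padicHaar_padicUnitBall (p := p) (d := d), hcover, measure_biUnion_finset]
  · simp [measure_preimage_add, -neg_add_rev]
  · intro m hm n hn hmn
    rw [Function.onFun, Set.disjoint_left]
    rintro x ⟨y, hy, h⟩ ⟨y', hy', h'⟩
    have hx : x = vecCast ℚ_[p] m + (matCast ℚ_[p] A).mulVec y := by rw [h]; simp
    have hx' : x = vecCast ℚ_[p] n + (matCast ℚ_[p] A).mulVec y' := by rw [h']; simp
    have hxB : x ∈ padicUnitBall p d := by
      rw [hx]
      exact add_mem_padicUnitBall (vecCast_mem_padicUnitBall m)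
        (matCast_mulVec_mem_padicUnitBall A hy)
    exact hmn ((hD x hxB).unique ⟨hm, y, hy, by rw [hx]; abel⟩ ⟨hn, y', hy', by rw [hx']; abel⟩)
  · intro n _
    exact hLm.preimage (continuous_const_add _).measurable

/-- Since `ρ(A ℤ_p^d) = A⁻¹ R`, this set has volume `|det A|⁻¹`, while the Haar measure of `A ℤ_p^d`
is `1/|D|`. -/
theorem IsPadicContraction.natAbs_det_eq_card (hA : IsPadicContraction p A)
    (hdet : A.det ≠ 0) (hD : IsPadicDigitSet p A D) (hD0 : (0 : Fin d → ℤ) ∈ D)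
    (hconv : RealSeriesConverge A D) (hρ : ConservesMeasure (rho p A D)) :
    A.det.natAbs = D.card := by
  have h1 := hρ _ (isCompact_image_padicUnitBall (A := A)).isClosed.measurableSet
  have h2 : rho p A D '' ((matCast ℚ_[p] A).mulVec '' padicUnitBall p d) =
      Matrix.toLin' (matCast ℝ A)⁻¹ '' (rho p A D '' padicUnitBall p d) := by
    rw [Set.image_image, Set.image_image]
    exact Set.image_congr fun x hx => hA.rho_mulVec hdet hD hD0 hconv hx
  rw [h2, Measure.addHaar_image_linearMap,
    hρ _ isCompact_padicUnitBall.isClosed.measurableSet, padicHaar_padicUnitBall, mul_one,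
    LinearMap.det_toLin', Matrix.det_nonsing_inv, Ring.inverse_eq_inv', det_matCast, abs_inv] at h1
  have h3 := hD.card_mul_padicHaar
  have hpos : (0 : ℝ) < |(A.det : ℝ)| := abs_pos.2 (Int.cast_ne_zero.2 hdet)
  rw [← h1, ← ENNReal.ofReal_natCast, ← ENNReal.ofReal_mul (by positivity), ENNReal.ofReal_eq_one,
    mul_inv_eq_one₀ hpos.ne'] at h3
  have h4 : ((A.det.natAbs : ℕ) : ℝ) = D.card := by rw [h3, Nat.cast_natAbs, Int.cast_abs]
  exact_mod_cast h4

theorem card_quotient_range_mulVecLin (hdet : A.det ≠ 0) :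
    Nat.card ((Fin d → ℤ) ⧸ LinearMap.range (Matrix.mulVecLin A)) = A.det.natAbs := by
  have hinj : Function.Injective (Matrix.mulVecLin A) :=
    Matrix.mulVec_injective_of_det_ne_zero hdet
  rw [← Submodule.natAbs_det_equiv _ (LinearEquiv.ofInjective _ hinj)]
  congr 1
  rw [← LinearMap.det_toLin' A]
  rfl

/-- Congruence modulo `A ℤ^d` implies congruence modulo `A ℤ_p^d`, so the digits inject into a
quotient of the same finite size. -/
theorem IsPadicDigitSet.isIntegerDigitSet (hD : IsPadicDigitSet p A D) (hdet : A.det ≠ 0)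
    (hcard : A.det.natAbs = D.card) : IsIntegerDigitSet A D := by
  set N := LinearMap.range (Matrix.mulVecLin A) with hN
  have hq := card_quotient_range_mulVecLin hdet
  have : Finite ((Fin d → ℤ) ⧸ N) := Nat.finite_of_card_ne_zero (by
    rw [hq]; exact Int.natAbs_ne_zero.2 hdet)
  let f : D → (Fin d → ℤ) ⧸ N := fun n => N.mkQ n
  have hf : Function.Injective f := by
    rintro ⟨m, hm⟩ ⟨n, hn⟩ h
    obtain ⟨y, hy⟩ : m - n ∈ N := (Submodule.Quotient.eq N).1 h
    refine Subtype.ext ((hD _ (vecCast_mem_padicUnitBall m)).unique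
      ⟨hm, 0, zero_mem_padicUnitBall, by simp⟩
      ⟨hn, vecCast _ y, vecCast_mem_padicUnitBall y, ?_⟩)
    rw [← vecCast_sub, ← hy, Matrix.mulVecLin_apply, vecCast_mulVec]
  have hbij : Function.Bijective f := by
    rw [Nat.bijective_iff_injective_and_card]
    refine ⟨hf, ?_⟩
    rw [hq, hcard]
    simp
  intro x
  obtain ⟨⟨n, hn⟩, hnx⟩ := hbij.2 (N.mkQ x)
  refine ⟨n, ⟨hn, ?_⟩, ?_⟩
  · obtain ⟨y, hy⟩ : x - n ∈ N := (Submodule.Quotient.eq N).1 hnx.symm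
    exact ⟨y, hy.symm⟩
  · rintro m ⟨hm, y, hy⟩
    have : f ⟨m, hm⟩ = f ⟨n, hn⟩ := by
      rw [hnx]
      exact ((Submodule.Quotient.eq N).2 ⟨y, hy.symm⟩).symm
    exact congrArg Subtype.val (hf this)

/-- The determinant is a power of `p` up to sign if the integer digits represent the classes of
both lattices. -/
theorem exists_natAbs_det_eq_pow (hdet : A.det ≠ 0) (hD : IsPadicDigitSet p A D)
    (hD0 : (0 : Fin d → ℤ) ∈ D) (hZ : IsIntegerDigitSet A D) :
    ∃ j : ℕ, A.det.natAbs = p ^ j := by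
  have hp : p.Prime := Fact.out
  have hu : IsUnit (matCast ℚ_[p] A).det := by
    rw [det_matCast]; exact (Int.cast_ne_zero.2 hdet).isUnit
  -- `ℤ^d ∩ A ℤ_p^d = A ℤ^d`: the integer digit of `n` is also its `p`-adic digit, which is zero
  -- here.
  have hmem : ∀ (n : Fin d → ℤ) (y : Fin d → ℚ_[p]), y ∈ padicUnitBall p d →
      vecCast ℚ_[p] n = (matCast ℚ_[p] A).mulVec y → ∃ z, A.mulVec z = n := by
    intro n y hy h
    obtain ⟨c, ⟨hc, z, hz⟩, -⟩ := hZ n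
    have hc0 : c = 0 := (hD _ (vecCast_mem_padicUnitBall n)).unique
      ⟨hc, vecCast _ z, vecCast_mem_padicUnitBall z, by rw [← vecCast_sub, hz, vecCast_mulVec]⟩
      ⟨hD0, y, hy, by rw [vecCast_zero, sub_zero, h]⟩
    exact ⟨z, by rw [← hz, hc0, sub_zero]⟩
  have hcol : ∀ j : Fin d, ∀ᶠ k : ℕ in atTop, ∃ z, A.mulVec z = ((p : ℤ) ^ k) • Pi.single j 1 := by
    intro j
    set w := (matCast ℚ_[p] A)⁻¹.mulVec (Pi.single j 1) with hw
    -- For large `k` the vector `p^k A⁻¹ e_j` lies in `ℤ_p^d`, so `p^k e_j` lies in `A ℤ_p^d`.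
    have hlim : Tendsto (fun k : ℕ => ((p : ℚ_[p]) ^ k) • w) atTop (𝓝 0) := by
      simpa using (tendsto_pow_atTop_nhds_zero_of_norm_lt_one
        (Padic.norm_p_lt_one (p := p))).smul_const w
    filter_upwards [(NormedAddGroup.tendsto_nhds_zero.1 hlim) 1 one_pos] with k hk
    refine hmem _ _ hk.le ?_
    rw [Matrix.mulVec_smul, hw, Matrix.mulVec_mulVec, Matrix.mul_nonsing_inv _ hu,
      Matrix.one_mulVec]
    ext i
    simp [vecCast, Pi.single_apply]
  obtain ⟨k, hk⟩ := (eventually_all.2 hcol).exists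
  choose z hz using hk
  have hmul : A * (Matrix.of z).transpose = ((p : ℤ) ^ k) • 1 := by
    ext i j
    have := congrFun (hz j) i
    rw [Matrix.mul_apply]
    simpa [Matrix.mulVec, dotProduct, Matrix.one_apply, Pi.single_apply] using this
  have hdvd : A.det ∣ ((p ^ (k * d) : ℕ) : ℤ) := by
    refine ⟨(Matrix.of z).transpose.det, ?_⟩
    rw [← Matrix.det_mul, hmul, Matrix.det_smul, Matrix.det_one, mul_one, Fintype.card_fin,
      ← pow_mul]
    push_cast; rfl
  obtain ⟨j, -, hj⟩ := (Nat.dvd_prime_pow hp).1 (Int.natAbs_dvd_natAbs.2 hdvd)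
  exact ⟨j, hj⟩

theorem norm_intCast_eq_inv_abs {m : ℤ} {j : ℕ} (hm : m.natAbs = p ^ j) :
    ‖(m : ℚ_[p])‖ = |(m : ℝ)|⁻¹ := by
  have h1 : |(m : ℝ)| = (p : ℝ) ^ j := by
    rw [← Int.cast_abs, ← Nat.cast_natAbs, hm]; push_cast; rfl
  have h2 : ‖(m : ℚ_[p])‖ = ‖((p : ℚ_[p]) ^ j)‖ := by
    rcases Int.natAbs_eq m with h | h <;> rw [h, hm] <;> simp
  rw [h1, h2, norm_pow, Padic.norm_p, inv_pow]

end Conservation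

theorem mainTheorem5 (p : ℕ) [Fact p.Prime] (d : ℕ)
    (δ : (Fin d → ℚ_[p]) → (Fin d → ℚ_[p]) → ℝ) (hδ : IsDeformedMetric δ)
    (A : Matrix (Fin d) (Fin d) ℤ)
    (hA : IsDilation δ (Matrix.mulVecLin (matCast ℚ_[p] A)))
    (D : Finset (Fin d → ℤ)) (hD : IsPadicDigitSet p A D) (hD0 : (0 : Fin d → ℤ) ∈ D)
    (hconv : RealSeriesConverge A D)
    (hρ : ConservesMeasure (rho p A D)) :
    realTile A D = rho p A D '' padicUnitBall p d ∧
      ConditionA A D ∧ ConditionB A D ∧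
      ‖((A.det : ℤ) : ℚ_[p])‖ = |((A.det : ℤ) : ℝ)|⁻¹ := by
  have hdet := IsDilation.det_ne_zero hδ hA
  have hA' : IsPadicContraction p A := fun _ hε => IsDilation.exists_pow_norm_le hδ hA hε
  have hR := hA'.realTile_eq hdet hD hD0 hconv
  have hvol : volume (realTile A D) = 1 := by
    rw [hR, hρ _ isCompact_padicUnitBall.isClosed.measurableSet, padicHaar_padicUnitBall]
  have hcompact := hconv.isCompact_realTile hD0
  have hZ := hD.isIntegerDigitSet hdet (hA'.natAbs_det_eq_card hdet hD hD0 hconv hρ)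
  obtain ⟨j, hj⟩ := exists_natAbs_det_eq_pow hdet hD hD0 hZ
  refine ⟨hR, ⟨hZ, hcompact.isClosed.measurableSet.nullMeasurableSet, hvol⟩,
    fun k hk => ?_, norm_intCast_eq_inv_abs hj⟩
  exact volume_inter_translate_eq_zero hcompact
    (exists_sub_mem_realTile hconv hD0 hdet hZ (by simp [hvol])) hvol hk
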